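/- Let $\Gamma$ be a finite, simple, connected graph with vertex set $X$, path-length distance $\partial$ and diameter $D\ge 3$. Write $\Gamma_i(x)$ for the set of vertices at distance $i$ from $x$. Assume that $\Gamma$ is distance-regular, i.e. for all $0\le h,i,j\le D$ the number $p^h_{ij}=|\Gamma_i(x)\cap\Gamma_j(y)|$ is the same for all $x,y\in X$ with $\partial(x,y)=h$, and put $c_i=p^i_{1,i-1}$ $(1\le i\le D)$, $a_i=p^i_{1,i}$ $(0\le i\le D)$, $b_i=p^i_{1,i+1}$ $(0\le i\le D-1)$; let $k=b_0$ be the valency of $\Gamma$. Assume that: 1. $\Gamma$ has negative type: there are real numbers $b,\alpha,\beta$ with $b<-1$ such that, with ${j\brack 1}=1+b+\cdots+b^{j-1}$, $$c_i={i\brack 1}\Big(1+\alpha{i-1\brack 1}\Big)\ (1\le i\le D),\qquad b_i=\Big({D\brack 1}-{i\brack 1}\Big)\Big(\beta-\alpha{i\brack 1}\Big)\ (0\le i\le D-1);$$ 2. $a_1\neq 0$; 3. $\Gamma$ is not a near polygon, where $\Gamma$ is called a near polygon if $a_i=a_1c_i$ for $1\le i\le D-1$ and there are no vertices $u,v,w,z$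 with $u,v,w$ mutually adjacent, $\partial(u,z)=2$ and $\partial(v,z)=\partial(w,z)=1$. Fix $x\in X$ and let $\Delta=\Delta(x)$ be the subgraph of $\Gamma$ induced on the set of neighbours of $x$. Then: (i) $\Delta$ is a disjoint union of $k/(a_1+1)$ cliques, each consisting of $a_1+1$ vertices (in particular $a_1+1$ divides $k$), with no edges between different cliques. (ii) The eigenvalues of the adjacency matrix of $\Delta$ (the local eigenvalues of $\Gamma$) are precisely $a_1$, with multiplicity $k/(a_1+1)$, and $-1$, with multiplicity $ka_1/(a_1+1)$. -/

import Mathlib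

namespace DistReg

variable {V : Type*} [Fintype V]

/-- `|Γ_i(x) ∩ Γ_j(y)|`: the number of vertices at distance `i` from `x` and `j` from `y`. -/
noncomputable def sphereInterCard (G : SimpleGraph V) (i j : ℕ) (x y : V) : ℕ :=
  (Finset.univ.filter fun z => G.dist x z = i ∧ G.dist y z = j).card

/-- A connected graph is distance-regular if `|Γ_i(x) ∩ Γ_j(y)|` depends only on `i`, `j` and
the distance of `x` and `y`. -/
def IsDistanceRegular (G : SimpleGraph V) : Prop :=
  G.Connected ∧ ∀ h i j : ℕ, h ≤ G.diam → i ≤ G.diam → j ≤ G.diam →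
    ∀ x y x' y' : V, G.dist x y = h → G.dist x' y' = h →
      sphereInterCard G i j x y = sphereInterCard G i j x' y'

open Classical in
/-- The intersection number `p^h_{ij}`: the common value of `|Γ_i(x) ∩ Γ_j(y)|` over the pairs
`x, y` at distance `h`, evaluated at a chosen pair (and `0` if there is no such pair). -/
noncomputable def intersectionNumber (G : SimpleGraph V) (h i j : ℕ) : ℕ :=
  if hp : ∃ q : V × V, G.dist q.1 q.2 = h then
    sphereInterCard G i j hp.choose.1 hp.choose.2
  else 0

theorem IsDistanceRegular.intersectionNumber_eq {G : SimpleGraph V} (hG : IsDistanceRegular G)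
    {h i j : ℕ} (hh : h ≤ G.diam) (hi : i ≤ G.diam) (hj : j ≤ G.diam) {x y : V}
    (hxy : G.dist x y = h) : intersectionNumber G h i j = sphereInterCard G i j x y := by
  have hp : ∃ q : V × V, G.dist q.1 q.2 = h := ⟨(x, y), hxy⟩
  rw [intersectionNumber, dif_pos hp]
  exact hG.2 h i j hh hi hj _ _ _ _ hp.choose_spec hxy

/-- `a_i = p^i_{1,i}`. -/
noncomputable def aNum (G : SimpleGraph V) (i : ℕ) : ℕ := intersectionNumber G i 1 i

/-- `b_i = p^i_{1,i+1}` for `i < D`, and `b_D = 0`. -/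
noncomputable def bNum (G : SimpleGraph V) (i : ℕ) : ℕ :=
  if i < G.diam then intersectionNumber G i 1 (i + 1) else 0

/-- `c_i = p^i_{1,i-1}` for `1 ≤ i`, and `c_0 = 0`. -/
noncomputable def cNum (G : SimpleGraph V) : ℕ → ℕ
  | 0 => 0
  | i + 1 => intersectionNumber G (i + 1) 1 i

/-- The number `1 + b + ⋯ + b^(j-1)`. -/
def bracket (b : ℝ) (j : ℕ) : ℝ := ∑ l ∈ Finset.range j, b ^ l

/-- `G` has classical parameters `(D, b, α, β)`, where `D` is the diameter of `G`. -/
def HasClassicalParameters (G : SimpleGraph V) (D : ℕ) (b α β : ℝ) : Prop :=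
  G.diam = D ∧
  (∀ i : ℕ, 1 ≤ i → i ≤ D →
    (cNum G i : ℝ) = bracket b i * (1 + α * bracket b (i - 1))) ∧
  (∀ i : ℕ, i < D →
    (bNum G i : ℝ) = (bracket b D - bracket b i) * (β - α * bracket b i))

/-- `uvwz` is a kite of length `i` (used for `2 ≤ i`). -/
def IsKite (G : SimpleGraph V) (i : ℕ) (u v w z : V) : Prop :=
  G.Adj u v ∧ G.Adj u w ∧ G.Adj v w ∧
    G.dist u z = i ∧ G.dist v z = i - 1 ∧ G.dist w z = i - 1

/-- Near polygons (among distance-regular graphs): `a_i = a_1 c_i` for `1 ≤ i ≤ D - 1`, and there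
is no kite of length `2`. -/
def IsNearPolygon (G : SimpleGraph V) : Prop :=
  (∀ i : ℕ, 1 ≤ i → i < G.diam → aNum G i = aNum G 1 * cNum G i) ∧
    ¬ ∃ u v w z : V, IsKite G 2 u v w z

/-- `H` is the disjoint union of `m` cliques with `s` vertices each: the vertex set is partitioned
into `m` parts of size `s`, and two distinct vertices are adjacent iff they share a part. -/
def IsDisjointUnionOfCliques {W : Type*} [Fintype W] [DecidableEq W] (H : SimpleGraph W)
    (m s : ℕ) : Prop :=
  ∃ P : Finpartition (Finset.univ : Finset W),
    P.parts.card = m ∧ (∀ C ∈ P.parts, C.card = s) ∧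
      ∀ y z : W, H.Adj y z ↔ y ≠ z ∧ ∃ C ∈ P.parts, y ∈ C ∧ z ∈ C

/-- The local graph `Δ(x)`: the subgraph of `G` induced on the neighbours of `x`. -/
abbrev localGraph (G : SimpleGraph V) (x : V) : SimpleGraph (G.neighborSet x) :=
  G.induce (G.neighborSet x)

/-- The adjacency matrix of `Δ(x)`, acting on column vectors. -/
noncomputable def localAdj [DecidableEq V] (G : SimpleGraph V) [DecidableRel G.Adj] (x : V) :
    Module.End ℂ (G.neighborSet x → ℂ) :=
  Matrix.toLin' ((localGraph G x).adjMatrix ℂ)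

end DistReg

/-! The local graph is regular of degree `a_1`, so everything follows once adjacency in it is shown
to be transitive. A failure of transitivity is a kite of length 2. Since `D ≥ 3`, its far vertex has
a neighbour one step further from its tip, which turns it into a kite of length 3. It thus suffices
to exclude the latter (`not_isKite_three`).

The tool is the Q-polynomial structure given by classical parameters. Polynomials of degree at most
`j` in `b⁻¹ ^ d(·, z)` span a flag on which the adjacency matrix `A` is triangular, with eigenvalues
`θ_j` of the form `e + c₀ b ^ j + b₀ b⁻ʲ`. A Krein-type trace argument (`diagonal_mem_polyFlag`)
shows that `S = diag (b⁻¹ ^ d(y, ·))` raises the flag by at most one step. As `A` and `S` are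
symmetric, `S` is block tridiagonal on eigenspaces of `A`, and a cubic commutator relation follows
(`tridiagonal_relation`, `cubic_relation`). Its entries at pairs at distance 3 give the balanced set
condition (`balanced`).

Applied at the vertex `v` of a kite of length 3, this condition reduces to `m * b = t` with counts
`m ≥ 1` and `t ≥ 0`, which is impossible for `b < 0`. The spectrum then comes from `(A + 1)² = (a_1
+ 1)(A + 1)` for the local adjacency matrix, with multiplicities read off from traces. -/

namespace DistReg

/-! ### Counting neighbours by distance -/

section Counting

variable {V : Type*} {G : SimpleGraph V}

theorem exists_adj_dist_eq_of_dist_eq_succ {x z : V} {h : ℕ} (hG : G.Connected)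
    (hxz : G.dist x z = h + 1) : ∃ w, G.Adj x w ∧ G.dist w z = h := by
  obtain ⟨p, hp⟩ := hG.exists_walk_length_eq_dist x z
  cases p with
  | nil => simp at hxz
  | @cons _ w _ hadj p =>
    refine ⟨w, hadj, ?_⟩
    have h1 := SimpleGraph.dist_le p
    have h2 := hG.dist_triangle (u := x) (v := w) (w := z)
    have h3 := SimpleGraph.dist_eq_one_iff_adj.2 hadj
    simp only [SimpleGraph.Walk.length_cons] at hp
    omega

variable [Fintype V]

theorem IsDistanceRegular.dist_le_diam (hG : IsDistanceRegular G) (x y : V) :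
    G.dist x y ≤ G.diam := by
  have : Nonempty V := ⟨x⟩
  exact SimpleGraph.dist_le_diam (SimpleGraph.connected_iff_ediam_ne_top.1 hG.1)

theorem IsDistanceRegular.exists_dist_eq (hG : IsDistanceRegular G) {i : ℕ} (hi : i ≤ G.diam) :
    ∃ x z : V, G.dist x z = i := by
  have := hG.1.nonempty
  induction hi using Nat.decreasingInduction with
  | self => exact SimpleGraph.exists_dist_eq_diam
  | of_succ j hj ih =>
    obtain ⟨x, z, hxz⟩ := ih
    obtain ⟨w, -, hw⟩ := exists_adj_dist_eq_of_dist_eq_succ hG.1 hxz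
    exact ⟨w, z, hw⟩

variable [DecidableRel G.Adj]

theorem IsDistanceRegular.card_neighbor_closer (hG : IsDistanceRegular G) (x z : V) :
    ((G.neighborFinset x).filter fun w => G.dist w z + 1 = G.dist x z).card =
      cNum G (G.dist x z) := by
  rcases h : G.dist x z with _ | i
  · simp [cNum]
  · have hle := hG.dist_le_diam x z
    rw [cNum, hG.intersectionNumber_eq (by omega) (by omega) (by omega) h, sphereInterCard]
    congr 1
    ext w
    simp [SimpleGraph.dist_eq_one_iff_adj, SimpleGraph.dist_comm (u := z)]

theorem IsDistanceRegular.card_neighbor_farther (hG : IsDistanceRegular G) (x z : V) :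
    ((G.neighborFinset x).filter fun w => G.dist w z = G.dist x z + 1).card =
      bNum G (G.dist x z) := by
  rw [bNum]
  split_ifs with h
  · rw [hG.intersectionNumber_eq (by omega) (by omega) (by omega) rfl, sphereInterCard]
    congr 1
    ext w
    simp [SimpleGraph.dist_eq_one_iff_adj, SimpleGraph.dist_comm (u := z)]
  · rw [Finset.card_eq_zero, Finset.filter_eq_empty_iff]
    intro w _ hw
    have := hG.dist_le_diam w z
    omega

theorem IsDistanceRegular.card_common_neighbor (hG : IsDistanceRegular G) (hD : 1 ≤ G.diam)
    {x y : V} (h : G.Adj x y) :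
    ((G.neighborFinset x).filter fun w => G.Adj y w).card = aNum G 1 := by
  rw [aNum, hG.intersectionNumber_eq hD hD hD (SimpleGraph.dist_eq_one_iff_adj.2 h),
    sphereInterCard]
  congr 1
  ext w
  simp [SimpleGraph.dist_eq_one_iff_adj]

theorem IsDistanceRegular.cNum_ne_zero (hG : IsDistanceRegular G) {i : ℕ} (h1 : 1 ≤ i)
    (hi : i ≤ G.diam) : cNum G i ≠ 0 := by
  obtain ⟨x, z, rfl⟩ := hG.exists_dist_eq hi
  obtain ⟨w, hw, hwz⟩ :=
    exists_adj_dist_eq_of_dist_eq_succ hG.1 (Nat.sub_add_cancel h1).symm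
  rw [← hG.card_neighbor_closer, Finset.card_ne_zero]
  exact ⟨w, by simp [hw]; omega⟩

/-- Some pair is at distance `i + 1`; stepping along a geodesic shows `b_i ≠ 0`, and regularity
transfers this to every pair at distance `i`. -/
theorem IsDistanceRegular.exists_farther_neighbor (hG : IsDistanceRegular G) {x z : V}
    (h : G.dist x z < G.diam) : ∃ w, G.Adj x w ∧ G.dist w z = G.dist x z + 1 := by
  have hb : bNum G (G.dist x z) ≠ 0 := by
    obtain ⟨u, v, huv⟩ := hG.exists_dist_eq h
    obtain ⟨w, hw, hwv⟩ := exists_adj_dist_eq_of_dist_eq_succ hG.1 huv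
    rw [← hwv, ← hG.card_neighbor_farther, Finset.card_ne_zero]
    exact ⟨u, by simp [hw.symm]; omega⟩
  rw [← hG.card_neighbor_farther, Finset.card_ne_zero] at hb
  obtain ⟨w, hw⟩ := hb
  exact ⟨w, by simpa using hw⟩

/-- The three-term recurrence: summing a function of the distance to `z` over the neighbours
of `x`. -/
theorem IsDistanceRegular.sum_neighbor (hG : IsDistanceRegular G) {k : ℕ}
    (hk : G.IsRegularOfDegree k) (f : ℕ → ℝ) (x z : V) :
    ∑ w ∈ G.neighborFinset x, f (G.dist w z) =
      cNum G (G.dist x z) * f (G.dist x z - 1) + bNum G (G.dist x z) * f (G.dist x z + 1) +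
        (k - cNum G (G.dist x z) - bNum G (G.dist x z)) * f (G.dist x z) := by
  have hpt : ∀ w ∈ G.neighborFinset x, f (G.dist w z) = f (G.dist x z) +
      ((if G.dist w z + 1 = G.dist x z then f (G.dist x z - 1) - f (G.dist x z) else 0) +
      (if G.dist w z = G.dist x z + 1 then f (G.dist x z + 1) - f (G.dist x z) else 0)) := by
    intro w hw
    rw [SimpleGraph.mem_neighborFinset] at hw
    have h1 := hG.1.dist_triangle (u := x) (v := w) (w := z)
    have h2 := hG.1.dist_triangle (u := w) (v := x) (w := z)
    have h3 := SimpleGraph.dist_eq_one_iff_adj.2 hw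
    have h4 := SimpleGraph.dist_eq_one_iff_adj.2 hw.symm
    rcases (by omega : G.dist w z + 1 = G.dist x z ∨ G.dist w z = G.dist x z ∨
      G.dist w z = G.dist x z + 1) with h | h | h
    · rw [if_pos h, if_neg (by omega), ← h]; simp
    · rw [if_neg (by omega), if_neg (by omega), h]; simp
    · rw [if_neg (by omega), if_pos h, h]; simp
  rw [Finset.sum_congr rfl hpt, Finset.sum_add_distrib, Finset.sum_add_distrib,
    ← Finset.sum_filter, ← Finset.sum_filter, Finset.sum_const, Finset.sum_const,
    Finset.sum_const, hG.card_neighbor_closer, hG.card_neighbor_farther,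
    SimpleGraph.card_neighborFinset_eq_degree, hk.degree_eq]
  simp only [nsmul_eq_mul]
  ring

end Counting

/-! ### The Bose-Mesner algebra -/

section Algebra

variable {V : Type*} (G : SimpleGraph V)

/-- The matrix whose `(x, y)` entry is a given function of the distance of `x` and `y`. -/
noncomputable def distMatrix (f : ℕ → ℝ) : Matrix V V ℝ := Matrix.of fun x y => f (G.dist x y)

@[simp] theorem distMatrix_apply (f : ℕ → ℝ) (x y : V) :
    distMatrix G f x y = f (G.dist x y) := rfl

variable {G} [Fintype V] [DecidableRel G.Adj]

theorem IsDistanceRegular.adjMatrix_mul_distMatrix (hG : IsDistanceRegular G) {k : ℕ}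
    (hk : G.IsRegularOfDegree k) (f : ℕ → ℝ) :
    G.adjMatrix ℝ * distMatrix G f = distMatrix G fun h =>
      cNum G h * f (h - 1) + bNum G h * f (h + 1) + (k - cNum G h - bNum G h) * f h := by
  ext x z
  rw [SimpleGraph.adjMatrix_mul_apply]
  exact hG.sum_neighbor hk f x z

variable [DecidableEq V]

/-- The three-term recurrence can be solved for its top term because `c_{j+2} ≠ 0`. -/
theorem IsDistanceRegular.distMatrix_single_mem_adjoin (hG : IsDistanceRegular G) {k : ℕ}
    (hk : G.IsRegularOfDegree k) {i : ℕ} (hi : i ≤ G.diam) :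
    distMatrix G (Pi.single i 1) ∈ Algebra.adjoin ℝ {G.adjMatrix ℝ} := by
  induction i using Nat.strong_induction_on with
  | _ i ih =>
    match i with
    | 0 =>
      convert one_mem (Algebra.adjoin ℝ {G.adjMatrix ℝ})
      ext x y
      by_cases h : x = y
      · subst h
        simp [Matrix.one_apply_eq]
      · simp [Matrix.one_apply_ne h, hG.1.dist_eq_zero_iff, h]
    | 1 =>
      convert Algebra.self_mem_adjoin_singleton ℝ (G.adjMatrix ℝ)
      ext x y
      simp [Pi.single_apply, SimpleGraph.dist_eq_one_iff_adj, SimpleGraph.adjMatrix_apply]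
    | j + 2 =>
      have hA := Algebra.self_mem_adjoin_singleton ℝ (G.adjMatrix ℝ)
      have h0 := ih j (by omega) (by omega)
      have h1 := ih (j + 1) (by omega) (by omega)
      have hc : (cNum G (j + 2) : ℝ) ≠ 0 := by
        exact_mod_cast hG.cNum_ne_zero (by omega) hi
      have key : distMatrix G (Pi.single (j + 2) 1) = (cNum G (j + 2) : ℝ)⁻¹ •
          (G.adjMatrix ℝ * distMatrix G (Pi.single (j + 1) 1) -
            (bNum G j : ℝ) • distMatrix G (Pi.single j 1) -
            ((k : ℝ) - cNum G (j + 1) - bNum G (j + 1)) •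
              distMatrix G (Pi.single (j + 1) 1)) := by
        rw [hG.adjMatrix_mul_distMatrix hk]
        ext x y
        simp only [Matrix.smul_apply, Matrix.sub_apply, distMatrix_apply, smul_eq_mul,
          Pi.single_apply]
        rcases eq_or_ne (G.dist x y) j with h | h
        · simp [h]
        rcases eq_or_ne (G.dist x y) (j + 1) with h' | h'
        · simp [h']
        rcases eq_or_ne (G.dist x y) (j + 2) with h'' | h''
        · simp [h'', hc]
        · rw [if_neg h'', if_neg (by omega), if_neg (by omega), if_neg h', if_neg h]
          simp
      rw [key]
      exact Subalgebra.smul_mem _ (sub_mem (sub_mem (mul_mem hA h1)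
        (Subalgebra.smul_mem _ h0 _)) (Subalgebra.smul_mem _ h1 _)) _

theorem IsDistanceRegular.distMatrix_mem_adjoin (hG : IsDistanceRegular G) {k : ℕ}
    (hk : G.IsRegularOfDegree k) (f : ℕ → ℝ) :
    distMatrix G f ∈ Algebra.adjoin ℝ {G.adjMatrix ℝ} := by
  have key : distMatrix G f =
      ∑ i ∈ Finset.range (G.diam + 1), f i • distMatrix G (Pi.single i 1) := by
    ext x y
    have := hG.dist_le_diam x y
    simp only [Matrix.sum_apply, Matrix.smul_apply, distMatrix_apply, Pi.single_apply,
      smul_eq_mul, mul_ite, mul_one, mul_zero]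
    rw [Finset.sum_ite_eq, if_pos (Finset.mem_range.2 (by omega))]
  rw [key]
  refine sum_mem fun i hi => Subalgebra.smul_mem _ (hG.distMatrix_single_mem_adjoin hk ?_) _
  simp at hi
  omega

end Algebra

/-! ### Tridiagonal pairs of symmetric operators -/

section Tridiagonal

variable {E : Type*} [NormedAddCommGroup E] [InnerProductSpace ℝ E]

/-- The orthogonal layers of an increasing sequence of subspaces. -/
noncomputable def layer (U : ℕ → Submodule ℝ E) : ℕ → Submodule ℝ E
  | 0 => U 0
  | j + 1 => (U j)ᗮ ⊓ U (j + 1)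

theorem layer_le (U : ℕ → Submodule ℝ E) (j : ℕ) : layer U j ≤ U j := by
  cases j with
  | zero => exact le_rfl
  | succ j => exact inf_le_right

theorem inner_eq_zero_of_mem_layer {U : ℕ → Submodule ℝ E} (hU : Monotone U) {i j : ℕ}
    (hij : i < j) {v w : E} (hv : v ∈ U i) (hw : w ∈ layer U j) : inner ℝ v w = 0 := by
  cases j with
  | zero => omega
  | succ j => exact (Submodule.mem_orthogonal _ _).1 hw.1 v (hU (by omega) hv)

theorem eq_top_of_layer_le [FiniteDimensional ℝ E] {U : ℕ → Submodule ℝ E} (hU : Monotone U)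
    {D : ℕ} (hD : U D = ⊤) {K : Submodule ℝ E} (hK : ∀ j, layer U j ≤ K) : K = ⊤ := by
  have : ∀ j, U j ≤ K := by
    intro j
    induction j with
    | zero => exact hK 0
    | succ j ih =>
      rw [← Submodule.sup_orthogonal_inf_of_hasOrthogonalProjection (hU (Nat.le_succ j))]
      exact sup_le ih (hK (j + 1))
  exact top_le_iff.1 (hD ▸ this D)

/-- For `v` in layer `j + 1` the residue `T v - θ v` lies in `U j`. Since `T` is symmetric and
preserves `U j`, the residue is also orthogonal to `U j`, hence zero. -/
theorem apply_eq_smul_of_mem_layer {T : Module.End ℝ E} (hT : T.IsSymmetric)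
    {U : ℕ → Submodule ℝ E} (hU : Monotone U) {θ : ℕ → ℝ} (h0 : ∀ v ∈ U 0, T v = θ 0 • v)
    (hstep : ∀ j, ∀ v ∈ U (j + 1), T v - θ (j + 1) • v ∈ U j) {j : ℕ} {v : E}
    (hv : v ∈ layer U j) : T v = θ j • v := by
  have hTU : ∀ i, ∀ u ∈ U i, T u ∈ U i := by
    intro i u hu
    cases i with
    | zero => rw [h0 u hu]; exact Submodule.smul_mem _ _ hu
    | succ i =>
      have := add_mem (hU (Nat.le_succ i) (hstep i u hu)) (Submodule.smul_mem _ (θ (i + 1)) hu)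
      simpa using this
  cases j with
  | zero => exact h0 v hv
  | succ j =>
    have h1 := hstep j v hv.2
    have h2 : inner ℝ (T v - θ (j + 1) • v) (T v - θ (j + 1) • v) = 0 := by
      rw [inner_sub_right, ← hT, inner_smul_right,
        inner_eq_zero_of_mem_layer hU (Nat.lt_succ_self j) (hTU j _ h1) hv,
        inner_eq_zero_of_mem_layer hU (Nat.lt_succ_self j) h1 hv]
      simp
    exact sub_eq_zero.1 (inner_self_eq_zero.1 h2)

/-- If `T` acts triangularly along a flag, with diagonal entries satisfying a quadratic
recurrence, and `S` raises the flag by at most one step, then the symmetric operators `T` and `S`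
satisfy a cubic commutator relation. -/
theorem tridiagonal_relation [FiniteDimensional ℝ E] {T S : Module.End ℝ E}
    (hT : T.IsSymmetric) (hS : S.IsSymmetric)
    {U : ℕ → Submodule ℝ E} (hU : Monotone U) {D : ℕ} (hD : U D = ⊤) {θ : ℕ → ℝ}
    (h0 : ∀ v ∈ U 0, T v = θ 0 • v)
    (hstep : ∀ j, ∀ v ∈ U (j + 1), T v - θ (j + 1) • v ∈ U j)
    (hSU : ∀ j, ∀ v ∈ U j, S v ∈ U (j + 1)) {B γ ρ : ℝ}
    (hθ : ∀ j, θ j ^ 2 - B * θ j * θ (j + 1) + θ (j + 1) ^ 2 - γ * (θ j + θ (j + 1)) - ρ = 0) :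
    T * T * T * S - (B + 1) • (T * T * S * T) + (B + 1) • (T * S * T * T) - S * T * T * T
      - γ • (T * T * S - S * T * T) - ρ • (T * S - S * T) = 0 := by
  set C := T * T * T * S - (B + 1) • (T * T * S * T) + (B + 1) • (T * S * T * T) - S * T * T * T
      - γ • (T * T * S - S * T * T) - ρ • (T * S - S * T) with hC
  have hTl : ∀ {j : ℕ} {v : E}, v ∈ layer U j → T v = θ j • v :=
    fun hv => apply_eq_smul_of_mem_layer hT hU h0 hstep hv
  have key : ∀ i j v w, v ∈ layer U i → w ∈ layer U j → inner ℝ (C w) v = 0 := by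
    intro i j v w hv hw
    -- Between eigenvectors the cubic becomes a scalar, the factor `θ i - θ j` times the quadratic
    -- of `hθ`.
    have h1 : inner ℝ (C w) v = (θ i - θ j) * (θ i ^ 2 - B * θ i * θ j + θ j ^ 2
        - γ * (θ i + θ j) - ρ) * inner ℝ (S w) v := by
      have hTi : ∀ u, inner ℝ (T u) v = θ i * inner ℝ u v := by
        intro u
        rw [hT, hTl hv, inner_smul_right]
      simp only [hC, LinearMap.sub_apply, LinearMap.add_apply, LinearMap.smul_apply,
        Module.End.mul_apply, inner_sub_left, inner_add_left, inner_smul_left, hTi, hTl hw,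
        map_smul]
      simp only [conj_trivial]
      ring
    rw [h1]
    -- Equal indices kill the linear factor, neighbouring ones the quadratic; for the rest `S` has
    -- no matrix entry.
    rcases lt_trichotomy i j with h | h | h
    · rcases (Nat.succ_le_of_lt h).eq_or_lt with h' | h'
      · subst h'
        rw [hθ i]; ring
      · rw [hS, real_inner_comm, inner_eq_zero_of_mem_layer hU h' (hSU i v (layer_le U i hv)) hw,
          mul_zero]
    · simp [h]
    · rcases (Nat.succ_le_of_lt h).eq_or_lt with h' | h'
      · subst h'
        linear_combination (θ (j + 1) - θ j) * inner ℝ (S w) v * hθ j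
      · rw [inner_eq_zero_of_mem_layer hU h' (hSU j w (layer_le U j hw)) hv, mul_zero]
  have h1 : ∀ j w, w ∈ layer U j → C w = 0 := by
    intro j w hw
    have : (Submodule.span ℝ {C w})ᗮ = ⊤ := by
      refine eq_top_of_layer_le hU hD fun i v hv => ?_
      rw [Submodule.mem_orthogonal_singleton_iff_inner_right]
      exact key i j v w hv hw
    rw [Submodule.orthogonal_eq_top_iff, Submodule.span_singleton_eq_bot] at this
    exact this
  exact LinearMap.ker_eq_top.1 (eq_top_of_layer_le hU hD h1)

end Tridiagonal

open Polynomial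

/-! ### Polynomials in `q ^ d` and the flag they span -/

section PolyMatrix

variable {V : Type*} (G : SimpleGraph V)

/-- The matrix with entries `p (q ^ d(x, y))`, as a linear function of the polynomial `p`. -/
noncomputable def polyMatrix (q : ℝ) : ℝ[X] →ₗ[ℝ] Matrix V V ℝ where
  toFun p := distMatrix G fun h => p.eval (q ^ h)
  map_add' p r := by ext; simp
  map_smul' c p := by ext; simp

@[simp] theorem polyMatrix_apply (q : ℝ) (p : ℝ[X]) (x y : V) :
    polyMatrix G q p x y = p.eval (q ^ G.dist x y) := rfl

theorem polyMatrix_isSymm (q : ℝ) (p : ℝ[X]) :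
    (polyMatrix G q p).transpose = polyMatrix G q p := by
  ext x y
  simp [SimpleGraph.dist_comm]

/-- The span of the columns of the matrices `polyMatrix G q p` with `p` of degree at most `j`. -/
noncomputable def polyFlag (q : ℝ) (j : ℕ) : Submodule ℝ (EuclideanSpace ℝ V) :=
  Submodule.span ℝ {v | ∃ p ∈ degreeLE ℝ j, ∃ z, v = WithLp.toLp 2 fun w => polyMatrix G q p w z}

theorem polyFlag_mono (q : ℝ) : Monotone (polyFlag G q) := by
  intro i j hij
  refine Submodule.span_mono ?_
  rintro v ⟨p, hp, z, rfl⟩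
  exact ⟨p, degreeLE_mono (by exact_mod_cast hij) hp, z, rfl⟩

theorem polyMatrix_col_mem_polyFlag (q : ℝ) {j : ℕ} {p : ℝ[X]} (hp : p ∈ degreeLE ℝ j) (z : V) :
    WithLp.toLp 2 (fun w => polyMatrix G q p w z) ∈ polyFlag G q j :=
  Submodule.subset_span ⟨p, hp, z, rfl⟩

variable {G} [Fintype V]

/-- A polynomial of degree `D` vanishing at `q, ..., q ^ D` but not at `1` gives a nonzero multiple
of the identity matrix. -/
theorem IsDistanceRegular.polyFlag_diam (hG : IsDistanceRegular G) {q : ℝ}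
    (hq : ∀ i, 1 ≤ i → q ^ i ≠ 1) : polyFlag G q G.diam = ⊤ := by
  classical
  set p : ℝ[X] := ∏ i ∈ Finset.Icc 1 G.diam, (X - C (q ^ i)) with hp
  have hdeg : p ∈ degreeLE ℝ (G.diam : ℕ) := by
    rw [mem_degreeLE, hp, degree_prod]
    simp only [degree_X_sub_C]
    simp
  have h1 : p.eval 1 ≠ 0 := by
    rw [hp, eval_prod, Finset.prod_ne_zero_iff]
    intro i hi
    rw [Finset.mem_Icc] at hi
    simpa [sub_eq_zero] using (hq i hi.1).symm
  have h2 : ∀ w z : V, polyMatrix G q p w z = if w = z then p.eval 1 else 0 := by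
    intro w z
    rw [polyMatrix_apply]
    split_ifs with h
    · simp [h]
    · rw [hp, eval_prod]
      refine Finset.prod_eq_zero (i := G.dist w z) ?_ (by simp)
      exact Finset.mem_Icc.2 ⟨hG.1.pos_dist_of_ne h, hG.dist_le_diam w z⟩
  rw [eq_top_iff, ← (EuclideanSpace.basisFun V ℝ).toBasis.span_eq, Submodule.span_le]
  rintro _ ⟨z, rfl⟩
  have h3 := Submodule.smul_mem _ (p.eval 1)⁻¹ (polyMatrix_col_mem_polyFlag G q hdeg z)
  have h4 : (EuclideanSpace.basisFun V ℝ).toBasis z =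
      (p.eval 1)⁻¹ • WithLp.toLp 2 fun w => polyMatrix G q p w z := by
    ext w
    simp [-polyMatrix_apply, h2, h1]
  rw [h4]
  exact h3

end PolyMatrix

/-! ### Triangular action of `A` for classical parameters -/

section Classical

variable {V : Type*} [Fintype V] {G : SimpleGraph V} {D : ℕ} {b α β : ℝ}

theorem bracket_eq (hb : b ≠ 1) (j : ℕ) : bracket b j = (b ^ j - 1) * (b - 1)⁻¹ := by
  rw [bracket, geom_sum_eq hb, div_eq_mul_inv]

/-- Classical parameters are quadratic in `b ^ h`, with proportional leading coefficients. -/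
theorem HasClassicalParameters.exists_quadratic (hcl : HasClassicalParameters G D b α β)
    (hb0 : b ≠ 0) (hb1 : b ≠ 1) : ∃ c₀ c₁ b₀ b₁ δ : ℝ, ∀ h ≤ D,
      (cNum G h : ℝ) = c₀ + c₁ * b ^ h + b⁻¹ * δ * (b ^ h) ^ 2 ∧
      (bNum G h : ℝ) = b₀ + b₁ * b ^ h + δ * (b ^ h) ^ 2 := by
  obtain ⟨hD, hc, hbn⟩ := hcl
  set g := (b - 1)⁻¹ with hg
  -- Expand the parameters with `bracket b j = (b ^ j - 1) * g`. The conventions `c_0 = 0` and `b_D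
  -- = 0` agree with these formulas.
  refine ⟨-g * (1 - α * g), g * (1 - α * g) - α * g ^ 2 * b⁻¹, (bracket b D + g) * (β + α * g),
    -g * (β + α * g + α * (bracket b D + g)), α * g ^ 2, fun h hh => ⟨?_, ?_⟩⟩
  · rcases Nat.eq_zero_or_pos h with rfl | hpos
    · simp [cNum]
      ring
    · obtain ⟨i, rfl⟩ := Nat.exists_eq_succ_of_ne_zero hpos.ne'
      rw [hc _ hpos hh, bracket_eq hb1, bracket_eq hb1]
      simp only [Nat.succ_eq_add_one, Nat.add_sub_cancel]
      rw [← hg, pow_succ]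
      field_simp
      ring
  · rcases hh.eq_or_lt with rfl | hlt
    · rw [bNum, if_neg (by omega), bracket_eq hb1, ← hg]
      push_cast
      ring
    · rw [hbn _ hlt, bracket_eq hb1 h, ← hg]
      ring

variable [DecidableRel G.Adj]

theorem IsDistanceRegular.adjMatrix_mul_polyMatrix_X_pow (hG : IsDistanceRegular G) {k : ℕ}
    (hk : G.IsRegularOfDegree k) (hb : b ≠ 0) {c₀ c₁ b₀ b₁ δ : ℝ}
    (hq : ∀ h ≤ G.diam, (cNum G h : ℝ) = c₀ + c₁ * b ^ h + b⁻¹ * δ * (b ^ h) ^ 2 ∧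
      (bNum G h : ℝ) = b₀ + b₁ * b ^ h + δ * (b ^ h) ^ 2) (n : ℕ) :
    ∃ r : ℝ[X], r.degree < n ∧
      G.adjMatrix ℝ * polyMatrix G b⁻¹ (X ^ n) -
        (k + c₀ * (b ^ n - 1) + b₀ * (b⁻¹ ^ n - 1)) • polyMatrix G b⁻¹ (X ^ n) =
      polyMatrix G b⁻¹ r := by
  set μ := c₁ * (b ^ n - 1) + b₁ * (b⁻¹ ^ n - 1) with hμ
  set ν := b⁻¹ * δ * (b ^ n - 1) + δ * (b⁻¹ ^ n - 1) with hν
  have key : ∀ x z, (G.adjMatrix ℝ * polyMatrix G b⁻¹ (X ^ n) -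
      (k + c₀ * (b ^ n - 1) + b₀ * (b⁻¹ ^ n - 1)) • polyMatrix G b⁻¹ (X ^ n)) x z =
      (b⁻¹ ^ G.dist x z) ^ n * (μ * b ^ G.dist x z + ν * (b ^ G.dist x z) ^ 2) := by
    intro x z
    have hA : (G.adjMatrix ℝ * polyMatrix G b⁻¹ (X ^ n)) x z = _ :=
      congrFun (congrFun (hG.adjMatrix_mul_distMatrix hk fun h => (X ^ n : ℝ[X]).eval (b⁻¹ ^ h))
        x) z
    obtain ⟨h1, h2⟩ := hq _ (hG.dist_le_diam x z)
    rw [Matrix.sub_apply, Matrix.smul_apply, hA]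
    simp only [distMatrix_apply, polyMatrix_apply, eval_pow, eval_X, smul_eq_mul]
    -- At distance `0` the truncated `dist - 1` is harmless, since `c_0 = 0`.
    have hcb : (cNum G (G.dist x z) : ℝ) * (b⁻¹ ^ (G.dist x z - 1)) ^ n =
        cNum G (G.dist x z) * ((b⁻¹ ^ G.dist x z) ^ n * b ^ n) := by
      rcases G.dist x z with _ | i
      · simp [cNum]
      · rw [Nat.add_sub_cancel, pow_succ, mul_pow, mul_assoc, ← mul_pow b⁻¹, inv_mul_cancel₀ hb,
          one_pow, mul_one]
    rw [hcb, pow_succ b⁻¹ (G.dist x z), mul_pow, h1, h2, hμ, hν]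
    ring
  rcases n with _ | _ | n
  · refine ⟨0, by simp, ?_⟩
    ext x z
    rw [key]
    simp [hμ, hν]
  · refine ⟨C μ, by simpa using degree_C_lt, ?_⟩
    ext x z
    rw [key]
    -- Otherwise a term `b ^ h`, not a polynomial in `b⁻¹ ^ h`, would survive. The ratio `b⁻¹` of
    -- the leading coefficients of `c_h` and `b_h` is what removes it.
    have hν0 : ν = 0 := by
      rw [hν]
      linear_combination δ * inv_mul_cancel₀ hb
    have : (b⁻¹ ^ G.dist x z) * b ^ G.dist x z = 1 := by
      rw [← mul_pow, inv_mul_cancel₀ hb, one_pow]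
    simp only [hν0, polyMatrix_apply, eval_C]
    linear_combination μ * this
  · refine ⟨C μ * X ^ (n + 1) + C ν * X ^ n, ?_, ?_⟩
    · refine lt_of_le_of_lt (degree_add_le _ _) (max_lt ?_ ?_)
      · exact lt_of_le_of_lt (degree_C_mul_X_pow_le _ _) (by exact_mod_cast Nat.lt_succ_self _)
      · exact lt_of_le_of_lt (degree_C_mul_X_pow_le _ _) (by exact_mod_cast (by omega))
    · ext x z
      rw [key]
      have : (b⁻¹ ^ G.dist x z) * b ^ G.dist x z = 1 := by
        rw [← mul_pow, inv_mul_cancel₀ hb, one_pow]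
      simp only [polyMatrix_apply, eval_add, eval_mul, eval_C, eval_pow, eval_X]
      generalize b⁻¹ ^ G.dist x z = Y at *
      generalize b ^ G.dist x z = Z at *
      linear_combination (μ * Y ^ (n + 1) + ν * Y ^ n * (Y * Z + 1)) * this

end Classical

/-! ### Pointwise multiplication on the flag -/

section Flag

variable {V : Type*} [Fintype V] [DecidableEq V] {G : SimpleGraph V} [DecidableRel G.Adj]

/-- If multiplication by the adjacency matrix preserves the polynomial matrices of degree at most
`j`, then so does multiplication by every matrix of the Bose-Mesner algebra. -/
theorem mul_polyMatrix_mem_of_mem_adjoin {q : ℝ} {j : ℕ}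
    (hA : ∀ p ∈ degreeLE ℝ j,
      G.adjMatrix ℝ * polyMatrix G q p ∈ (degreeLE ℝ j).map (polyMatrix G q))
    {M : Matrix V V ℝ} (hM : M ∈ Algebra.adjoin ℝ {G.adjMatrix ℝ}) :
    ∀ p ∈ degreeLE ℝ j, M * polyMatrix G q p ∈ (degreeLE ℝ j).map (polyMatrix G q) := by
  induction hM using Algebra.adjoin_induction with
  | mem x hx =>
    rw [Set.mem_singleton_iff] at hx
    rwa [hx]
  | algebraMap r =>
    intro p hp
    rw [Algebra.algebraMap_eq_smul_one, smul_mul_assoc, one_mul]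
    exact Submodule.smul_mem _ _ (Submodule.mem_map_of_mem hp)
  | add x y _ _ hx hy =>
    intro p hp
    rw [add_mul]
    exact add_mem (hx p hp) (hy p hp)
  | mul x y _ _ hx hy =>
    intro p hp
    obtain ⟨r, hr, hr'⟩ := hy p hp
    rw [mul_assoc, ← hr']
    exact hx r hr

/-- Pointwise multiplication by a polynomial of degree `i` in `q ^ d(y, ·)` raises the flag by at
most `i` steps. -/
theorem IsDistanceRegular.diagonal_mem_polyFlag (hG : IsDistanceRegular G) {k : ℕ}
    (hk : G.IsRegularOfDegree k) {q : ℝ}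
    (hA : ∀ j : ℕ, ∀ p ∈ degreeLE ℝ j,
      G.adjMatrix ℝ * polyMatrix G q p ∈ (degreeLE ℝ j).map (polyMatrix G q))
    {i : ℕ} {s : ℝ[X]} (hs : s ∈ degreeLE ℝ i) (y : V) (j : ℕ) (v : EuclideanSpace ℝ V)
    (hv : v ∈ polyFlag G q j) :
    Matrix.toLpLinAlgEquiv 2 (Matrix.diagonal fun w => polyMatrix G q s y w) v ∈
      polyFlag G q (j + i) := by
  have hsq : ∀ {j : ℕ} {p : ℝ[X]}, p ∈ degreeLE ℝ j →
      ∃ r ∈ degreeLE ℝ j, polyMatrix G q r = polyMatrix G q p * polyMatrix G q p :=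
    fun {j p} hp => mul_polyMatrix_mem_of_mem_adjoin (hA j)
      (hG.distMatrix_mem_adjoin hk fun h => p.eval (q ^ h)) p hp
  induction hv using Submodule.span_induction with
  | zero => simp
  | add v w _ _ hv hw => rw [map_add]; exact add_mem hv hw
  | smul c v _ hv => rw [map_smul]; exact Submodule.smul_mem _ _ hv
  | mem v hv =>
    obtain ⟨p, hp, z, rfl⟩ := hv
    -- It is enough to test against each `g` orthogonal to the target; such a `g` will satisfy `P_s
    -- diag(g) P_p = 0`.
    rw [← Submodule.orthogonal_orthogonal (polyFlag G q (j + i)), Submodule.mem_orthogonal]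
    intro g hg
    obtain ⟨r, hr, hr'⟩ := hsq hp
    obtain ⟨t, ht, ht'⟩ := hsq hs
    have hrt : r * t ∈ degreeLE ℝ ((j + i : ℕ) : WithBot ℕ) := by
      rw [mem_degreeLE] at *
      push_cast
      exact (degree_mul_le _ _).trans (add_le_add hr ht)
    set Δ : Matrix V V ℝ := Matrix.diagonal fun w => g w
    -- The squared Frobenius norm is `∑ g(u) g(w) r t`, where `r` and `t` represent `P_p²` and
    -- `P_s²`. The product `r * t` has degree at most `j + i`, so the sum over `u` vanishes by the
    -- choice of `g`.
    have hT : polyMatrix G q s * Δ * polyMatrix G q p = 0 := by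
      rw [← Matrix.trace_mul_conjTranspose_self_eq_zero_iff,
        Matrix.conjTranspose_eq_transpose_of_trivial, Matrix.transpose_mul, Matrix.transpose_mul, polyMatrix_isSymm, polyMatrix_isSymm,
        Matrix.diagonal_transpose]
      have : polyMatrix G q s * Δ * polyMatrix G q p * (polyMatrix G q p * (Δ * polyMatrix G q s))
          = polyMatrix G q s * (Δ * polyMatrix G q r * Δ * polyMatrix G q s) := by
        rw [hr']; simp only [mul_assoc]
      rw [this, Matrix.trace_mul_comm, mul_assoc, ← ht', Matrix.trace]
      refine Finset.sum_eq_zero fun w _ => ?_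
      have horth := (Submodule.mem_orthogonal _ _).1 hg _
        (polyMatrix_col_mem_polyFlag G q hrt w)
      simp only [PiLp.inner_apply, polyMatrix_apply, eval_mul] at horth
      rw [Matrix.diag_apply, Matrix.mul_apply]
      simp only [Δ, Matrix.mul_diagonal, Matrix.diagonal_mul, polyMatrix_apply]
      calc _ = g w * ∑ u, inner ℝ (eval (q ^ G.dist u w) r * eval (q ^ G.dist u w) t) (g u) := by
            rw [Finset.mul_sum]
            refine Finset.sum_congr rfl fun u _ => ?_
            rw [SimpleGraph.dist_comm (u := w)]
            simp
            ring
        _ = 0 := by rw [horth, mul_zero]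
    have := congrFun (congrFun hT y) z
    rw [Matrix.mul_apply] at this
    simp only [Δ, Matrix.mul_diagonal, Matrix.zero_apply] at this
    rw [← this, PiLp.inner_apply]
    refine Finset.sum_congr rfl fun u _ => ?_
    simp [Matrix.toLpLinAlgEquiv, Matrix.toLpLin_apply, Matrix.mulVec_diagonal]
    ring

end Flag

/-! ### The cubic relation between `A` and `S` -/

section Cubic

variable {V : Type*} [Fintype V] [DecidableEq V] {G : SimpleGraph V} [DecidableRel G.Adj]

theorem toLpLinAlgEquiv_isSymmetric {A : Matrix V V ℝ} (hA : A.transpose = A) :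
    (Matrix.toLpLinAlgEquiv 2 A : Module.End ℝ (EuclideanSpace ℝ V)).IsSymmetric := by
  refine Matrix.isSymmetric_toEuclideanLin_iff.2 ?_
  rw [Matrix.IsHermitian, Matrix.conjTranspose_eq_transpose_of_trivial, hA]

theorem sub_smul_mem_of_X_pow {q : ℝ} {θ : ℕ → ℝ}
    (hθ : ∀ n : ℕ, ∃ r : ℝ[X], r.degree < n ∧
      G.adjMatrix ℝ * polyMatrix G q (X ^ n) - θ n • polyMatrix G q (X ^ n) = polyMatrix G q r)
    (j : ℕ) {p : ℝ[X]} (hp : p ∈ degreeLE ℝ j) : ∃ r : ℝ[X], r.degree < j ∧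
      G.adjMatrix ℝ * polyMatrix G q p - θ j • polyMatrix G q p = polyMatrix G q r := by
  rw [degreeLE_eq_span_X_pow] at hp
  induction hp using Submodule.span_induction with
  | zero => exact ⟨0, by simp, by simp⟩
  | add p s _ _ hp hs =>
    obtain ⟨r, hr, hr'⟩ := hp
    obtain ⟨t, ht, ht'⟩ := hs
    refine ⟨r + t, lt_of_le_of_lt (degree_add_le _ _) (max_lt hr ht), ?_⟩
    rw [map_add, map_add, ← hr', ← ht', mul_add, smul_add]
    abel
  | smul c p _ hp =>
    obtain ⟨r, hr, hr'⟩ := hp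
    refine ⟨c • r, lt_of_le_of_lt (degree_smul_le _ _) hr, ?_⟩
    rw [map_smul, map_smul, ← hr', smul_sub, Matrix.mul_smul, smul_comm (θ j)]
  | mem p hp =>
    simp only [Finset.coe_image, Set.mem_image, Finset.mem_coe, Finset.mem_range] at hp
    obtain ⟨n, hn, rfl⟩ := hp
    obtain ⟨r, hr, hr'⟩ := hθ n
    rcases (Nat.lt_succ_iff.1 hn).eq_or_lt with rfl | hlt
    · exact ⟨r, hr, hr'⟩
    · refine ⟨r + (θ n - θ j) • X ^ n, lt_of_le_of_lt (degree_add_le _ _) (max_lt ?_ ?_), ?_⟩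
      · exact hr.trans (by exact_mod_cast hlt)
      · refine lt_of_le_of_lt (degree_smul_le _ _) (lt_of_le_of_lt (degree_X_pow_le n) ?_)
        exact_mod_cast hlt
      · rw [map_add, map_smul, ← hr', sub_smul]
        abel

theorem IsDistanceRegular.cubic_relation (hG : IsDistanceRegular G) {k : ℕ}
    (hk : G.IsRegularOfDegree k) {b α β : ℝ}
    (hcl : HasClassicalParameters G G.diam b α β) (hb0 : b ≠ 0) (hb : ∀ i, 1 ≤ i → b ^ i ≠ 1)
    (y : V) {A S : Matrix V V ℝ} (hA : A = G.adjMatrix ℝ)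
    (hS : S = Matrix.diagonal fun w => b⁻¹ ^ G.dist y w) : ∃ γ ρ : ℝ,
    A * A * A * S - (b + b⁻¹ + 1) • (A * A * S * A) + (b + b⁻¹ + 1) • (A * S * A * A)
      - S * A * A * A - γ • (A * A * S - S * A * A) - ρ • (A * S - S * A) = 0 := by
  have hb1 : b ≠ 1 := by simpa using hb 1 le_rfl
  obtain ⟨c₀, c₁, b₀, b₁, δ, hq⟩ := hcl.exists_quadratic hb0 hb1
  set θ : ℕ → ℝ := fun n => k + c₀ * (b ^ n - 1) + b₀ * (b⁻¹ ^ n - 1) with hθ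
  have hstep : ∀ j : ℕ, ∀ p ∈ degreeLE ℝ j, ∃ r : ℝ[X], r.degree < j ∧
      G.adjMatrix ℝ * polyMatrix G b⁻¹ p - θ j • polyMatrix G b⁻¹ p = polyMatrix G b⁻¹ r :=
    fun j _ hp => sub_smul_mem_of_X_pow (hG.adjMatrix_mul_polyMatrix_X_pow hk hb0 hq) j hp
  have hinv : ∀ j : ℕ, ∀ p ∈ degreeLE ℝ j, G.adjMatrix ℝ * polyMatrix G b⁻¹ p ∈
      (degreeLE ℝ j).map (polyMatrix G b⁻¹) := by
    intro j p hp
    obtain ⟨r, hr, hr'⟩ := hstep j p hp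
    refine ⟨r + θ j • p, add_mem (mem_degreeLE.2 hr.le) (Submodule.smul_mem _ _ hp), ?_⟩
    rw [map_add, map_smul, ← hr']
    abel
  have hSpoly : S = Matrix.diagonal fun w => polyMatrix G b⁻¹ X y w := by
    rw [hS]
    simp
  set e := (k : ℝ) - c₀ - b₀ with he
  set B := b + b⁻¹ with hB
  have hcol : ∀ (p : ℝ[X]) (c : ℝ) (z : V),
      Matrix.toLpLinAlgEquiv 2 A (WithLp.toLp 2 fun w => polyMatrix G b⁻¹ p w z) -
        c • WithLp.toLp 2 (fun w => polyMatrix G b⁻¹ p w z) =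
      WithLp.toLp 2 fun w =>
        (G.adjMatrix ℝ * polyMatrix G b⁻¹ p - c • polyMatrix G b⁻¹ p) w z := by
    intro p c z
    rw [hA]
    rfl
  -- The sequence `x_j = c₀ b ^ j + b₀ b⁻ʲ` satisfies `x_j² - B x_j x_{j+1} + x_{j+1}² = c₀ b₀ (4 -
  -- B²)`; substituting `x_j = θ_j - e` gives `γ` and `ρ`.
  refine ⟨e * (2 - B), c₀ * b₀ * (4 - B ^ 2) - e ^ 2 * (2 - B), ?_⟩
  have key := tridiagonal_relation
    (T := Matrix.toLpLinAlgEquiv 2 A) (S := Matrix.toLpLinAlgEquiv 2 S)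
    (toLpLinAlgEquiv_isSymmetric (by rw [hA, SimpleGraph.transpose_adjMatrix]))
    (toLpLinAlgEquiv_isSymmetric (by rw [hS, Matrix.diagonal_transpose]))
    (polyFlag_mono G b⁻¹)
    (hG.polyFlag_diam (q := b⁻¹) fun i hi h => hb i hi (by simpa using h)) (θ := θ)
    (B := B) (γ := e * (2 - B)) (ρ := c₀ * b₀ * (4 - B ^ 2) - e ^ 2 * (2 - B))
    (by
      intro v hv
      rw [← sub_eq_zero]
      induction hv using Submodule.span_induction with
      | zero => simp
      | add v w _ _ hv hw =>
        rw [map_add, smul_add, add_sub_add_comm, hv, hw, add_zero]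
      | smul c v _ hv => rw [map_smul, smul_comm, ← smul_sub, hv, smul_zero]
      | mem v hv =>
        obtain ⟨p, hp, z, rfl⟩ := hv
        obtain ⟨r, hr, hr'⟩ := hstep 0 p hp
        have hr0 : r = 0 := by
          simpa using hr
        rw [hcol, hr', hr0]
        simp
        rfl)
    (by
      intro j v hv
      induction hv using Submodule.span_induction with
      | zero => simp
      | add v w _ _ hv hw =>
        rw [map_add, smul_add, add_sub_add_comm]
        exact add_mem hv hw
      | smul c v _ hv =>
        rw [map_smul, smul_comm, ← smul_sub]
        exact Submodule.smul_mem _ _ hv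
      | mem v hv =>
        obtain ⟨p, hp, z, rfl⟩ := hv
        obtain ⟨r, hr, hr'⟩ := hstep (j + 1) p hp
        rw [hcol, hr']
        refine polyMatrix_col_mem_polyFlag G b⁻¹ (mem_degreeLE.2 ?_) z
        exact (degree_le_iff_coeff_zero _ _).2 fun m hm => coeff_eq_zero_of_degree_lt
          (hr.trans_le (by exact_mod_cast hm)))
    (by
      intro j v hv
      rw [hSpoly]
      exact hG.diagonal_mem_polyFlag hk hinv (i := 1) (mem_degreeLE.2 degree_X_le) y j v hv)
    (by
      intro j
      have h1 : b * b⁻¹ = 1 := mul_inv_cancel₀ hb0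
      have h2 : b ^ j * b⁻¹ ^ j = 1 := by rw [← mul_pow, h1, one_pow]
      simp only [hθ, hB, he, pow_succ]
      generalize b⁻¹ = d at *
      generalize b ^ j = Y at *
      generalize d ^ j = Z at *
      linear_combination (-c₀ ^ 2 * Y ^ 2 - b₀ ^ 2 * Z ^ 2 + 2 * c₀ * b₀) * h1 +
        c₀ * b₀ * (2 + 2 * b * d - (b + d) ^ 2) * h2)
  apply (Matrix.toLpLinAlgEquiv (R := ℝ) (n := V) 2).injective
  simpa only [map_sub, map_add, map_mul, map_smul, map_zero] using key

end Cubic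

/-! ### The balanced set condition and kites -/

section Kites

variable {V : Type*} [Fintype V] {G : SimpleGraph V} [DecidableRel G.Adj]

theorem IsDistanceRegular.adjMatrix_mul_self_apply (hG : IsDistanceRegular G) {k : ℕ}
    (hk : G.IsRegularOfDegree k) {x z : V} (h : 2 ≤ G.dist x z) :
    (G.adjMatrix ℝ * G.adjMatrix ℝ) x z = if G.dist x z = 2 then (cNum G 2 : ℝ) else 0 := by
  have hA : G.adjMatrix ℝ = distMatrix G (Pi.single 1 1) := by
    ext x y
    simp [Pi.single_apply, SimpleGraph.dist_eq_one_iff_adj, SimpleGraph.adjMatrix_apply]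
  have : G.adjMatrix ℝ * G.adjMatrix ℝ = G.adjMatrix ℝ * distMatrix G (Pi.single 1 1) := by
    rw [← hA]
  rw [this, hG.adjMatrix_mul_distMatrix hk, distMatrix_apply]
  simp only [Pi.single_apply]
  rw [if_neg (by omega : ¬ G.dist x z + 1 = 1), if_neg (by omega : ¬ G.dist x z = 1)]
  by_cases h2 : G.dist x z = 2
  · simp [h2]
  · rw [if_neg (by omega), if_neg h2]
    simp

theorem IsDistanceRegular.sum_neighbor_adjMatrix_mul_self (hG : IsDistanceRegular G) {k : ℕ}
    (hk : G.IsRegularOfDegree k) {u z : V} (huz : G.dist z u = 3) (s : V → ℝ) :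
    ∑ w ∈ G.neighborFinset z, (G.adjMatrix ℝ * G.adjMatrix ℝ) w u * s w =
      cNum G 2 * ∑ w ∈ G.neighborFinset z with G.dist w u = 2, s w := by
  rw [Finset.mul_sum, Finset.sum_filter]
  refine Finset.sum_congr rfl fun w hw => ?_
  rw [SimpleGraph.mem_neighborFinset] at hw
  have h1 := hG.1.dist_triangle (u := z) (v := w) (w := u)
  have h2 := SimpleGraph.dist_eq_one_iff_adj.2 hw
  rw [hG.adjMatrix_mul_self_apply hk (by omega)]
  split_ifs <;> simp

variable [DecidableEq V]

/-- The balanced set condition for the neighbours of two vertices at distance three. -/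
theorem IsDistanceRegular.balanced (hG : IsDistanceRegular G) {k : ℕ}
    (hk : G.IsRegularOfDegree k) {b α β : ℝ}
    (hcl : HasClassicalParameters G G.diam b α β) (hb0 : b ≠ 0) (hb : ∀ i, 1 ≤ i → b ^ i ≠ 1)
    (y : V) {u z : V} (huz : G.dist u z = 3) :
    (b + b⁻¹ + 1) * (∑ w ∈ G.neighborFinset u with G.dist w z = 2, b⁻¹ ^ G.dist y w -
      ∑ w ∈ G.neighborFinset z with G.dist w u = 2, b⁻¹ ^ G.dist y w) =
      cNum G 3 * (b⁻¹ ^ G.dist y u - b⁻¹ ^ G.dist y z) := by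
  have hzu : G.dist z u = 3 := by rw [SimpleGraph.dist_comm, huz]
  set A := G.adjMatrix ℝ with hA
  set s : V → ℝ := fun w => b⁻¹ ^ G.dist y w with hs
  obtain ⟨γ, ρ, hrel⟩ := hG.cubic_relation hk hcl hb0 hb y hA (S := Matrix.diagonal s) rfl
  -- At distance 3 the entries of `A` and `A²` vanish, so the unknown `γ` and `ρ` drop out.
  have hrel := congrFun (congrFun hrel u) z
  have hAA : (A * A).transpose = A * A := by
    rw [Matrix.transpose_mul, hA, SimpleGraph.transpose_adjMatrix]
  have hAA' : ∀ p r, (A * A) p r = (A * A) r p := fun p r => congrFun (congrFun hAA r) p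
  have hAuz : A u z = 0 := by
    rw [hA, SimpleGraph.adjMatrix_apply, if_neg]
    intro h
    have := SimpleGraph.dist_eq_one_iff_adj.2 h
    omega
  have hAAuz : (A * A) u z = 0 := by
    rw [hG.adjMatrix_mul_self_apply hk (by omega), if_neg (by omega)]
  have e1 : (A * A * A) u z = cNum G 2 * cNum G 3 := by
    have h := hG.sum_neighbor_adjMatrix_mul_self hk hzu fun _ => 1
    rw [Finset.sum_const, nsmul_eq_mul, mul_one] at h
    have h3 := hG.card_neighbor_closer z u
    simp only [hzu] at h3
    simp only [Nat.reduceEqDiff] at h3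
    rw [h3] at h
    rw [hA, SimpleGraph.mul_adjMatrix_apply, ← h]
    refine Finset.sum_congr rfl fun w _ => ?_
    rw [mul_one]
    exact hAA' u w
  have e2 : (A * A * Matrix.diagonal s * A) u z =
      cNum G 2 * ∑ w ∈ G.neighborFinset z with G.dist w u = 2, s w := by
    rw [← hG.sum_neighbor_adjMatrix_mul_self hk hzu s]
    conv_lhs => rw [hA, SimpleGraph.mul_adjMatrix_apply]
    refine Finset.sum_congr rfl fun w _ => ?_
    rw [Matrix.mul_diagonal, ← hA, hAA' u w]
  have e3 : (A * Matrix.diagonal s * A * A) u z =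
      cNum G 2 * ∑ w ∈ G.neighborFinset u with G.dist w z = 2, s w := by
    rw [← hG.sum_neighbor_adjMatrix_mul_self hk huz s, mul_assoc, mul_assoc]
    conv_lhs => rw [hA, SimpleGraph.adjMatrix_mul_apply]
    refine Finset.sum_congr rfl fun w _ => ?_
    rw [Matrix.diagonal_mul, ← hA, mul_comm]
  have e4 : (Matrix.diagonal s * A * A * A) u z = s u * (cNum G 2 * cNum G 3) := by
    rw [← e1, mul_assoc, mul_assoc, Matrix.diagonal_mul, ← mul_assoc]
  have e5 : (Matrix.diagonal s * A * A) u z = 0 := by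
    rw [mul_assoc, Matrix.diagonal_mul, hAAuz, mul_zero]
  simp only [Matrix.sub_apply, Matrix.add_apply, Matrix.smul_apply, smul_eq_mul, e2, e3, e4, e5,
    Matrix.mul_diagonal, Matrix.diagonal_mul, e1, hAAuz, hAuz, Matrix.zero_apply] at hrel
  have hc2 : (cNum G 2 : ℝ) ≠ 0 := by
    have := hG.dist_le_diam u z
    exact_mod_cast hG.cNum_ne_zero (by omega) (by omega)
  apply mul_left_cancel₀ hc2
  linear_combination hrel

theorem IsDistanceRegular.not_isKite_three (hG : IsDistanceRegular G) {k : ℕ}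
    (hk : G.IsRegularOfDegree k) {b α β : ℝ}
    (hcl : HasClassicalParameters G G.diam b α β) (hneg : b < -1) (u v w z : V) :
    ¬ IsKite G 3 u v w z := by
  rintro ⟨huv, huw, hvw, huz, hvz, hwz⟩
  simp only [Nat.reduceSub] at hvz hwz
  have hD : 3 ≤ G.diam := huz ▸ hG.dist_le_diam u z
  have hb0 : b ≠ 0 := by linarith
  have hb : ∀ i, 1 ≤ i → b ^ i ≠ 1 := by
    intro i hi h
    have h1 : 1 < |b| := by rw [abs_of_neg (by linarith)]; linarith
    have h2 := one_lt_pow₀ h1 (by omega : i ≠ 0)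
    rw [← abs_pow, h, abs_one] at h2
    exact lt_irrefl _ h2
  have huv1 := SimpleGraph.dist_eq_one_iff_adj.2 huv
  have hvu1 := SimpleGraph.dist_eq_one_iff_adj.2 huv.symm
  have hzu : G.dist z u = 3 := by rw [SimpleGraph.dist_comm, huz]
  have hzv : G.dist z v = 2 := by rw [SimpleGraph.dist_comm, hvz]
  -- The base point is the kite vertex `v`, so that `w` contributes to the count `m` below.
  have hbal := hG.balanced hk hcl hb0 hb v huz
  rw [hvu1, hvz] at hbal
  set F₁ := (G.neighborFinset u).filter fun w => G.dist w z = 2 with hF₁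
  set F₂ := (G.neighborFinset z).filter fun w => G.dist w u = 2 with hF₂
  have hc₁ : F₁.card = cNum G 3 := by
    have h := hG.card_neighbor_closer u z
    simpa only [huz, Nat.reduceEqDiff] using h
  have hc₂ : F₂.card = cNum G 3 := by
    have h := hG.card_neighbor_closer z u
    simpa only [hzu, Nat.reduceEqDiff] using h
  have hvF : v ∈ F₁ := by simp [hF₁, huv, hvz]
  have hwF : w ∈ F₁ := by simp [hF₁, huw, hwz]
  set m := (F₁.filter fun w => G.dist v w = 1).card with hm
  set t := (F₂.filter fun w => G.dist v w = 2).card with ht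
  have hm1 : 1 ≤ m := Finset.card_pos.2
    ⟨w, Finset.mem_filter.2 ⟨hwF, SimpleGraph.dist_eq_one_iff_adj.2 hvw⟩⟩
  -- Common neighbours of `z` and `v` are automatically at distance 2 from `u`.
  have hclose : (F₂.filter fun w => G.dist v w = 1).card = cNum G 2 := by
    have h := hG.card_neighbor_closer z v
    simp only [hzv, Nat.reduceEqDiff] at h
    rw [← h]
    congr 1
    ext p
    simp only [hF₂, Finset.mem_filter, SimpleGraph.mem_neighborFinset]
    constructor
    · rintro ⟨⟨h1, -⟩, h2⟩
      exact ⟨h1, by rw [SimpleGraph.dist_comm, h2]⟩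
    · rintro ⟨h1, h2⟩
      have h3 := hG.1.dist_triangle (u := p) (v := v) (w := u)
      have h4 := hG.1.dist_triangle (u := z) (v := p) (w := u)
      have h5 := SimpleGraph.dist_eq_one_iff_adj.2 h1
      refine ⟨⟨h1, by omega⟩, by rw [SimpleGraph.dist_comm, h2]⟩
  set q := b⁻¹ with hq
  have hsum₁ : ∑ p ∈ F₁, q ^ G.dist v p = cNum G 3 * q ^ 2 + (1 - q ^ 2) + m * (q - q ^ 2) := by
    have hpt : ∀ p ∈ F₁, q ^ G.dist v p = q ^ 2 + ((if v = p then 1 - q ^ 2 else 0) +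
        if G.dist v p = 1 then q - q ^ 2 else 0) := by
      intro p hp
      simp only [hF₁, Finset.mem_filter, SimpleGraph.mem_neighborFinset] at hp
      have h1 := hG.1.dist_triangle (u := v) (v := u) (w := p)
      have h2 := SimpleGraph.dist_eq_one_iff_adj.2 hp.1
      by_cases hvp : v = p
      · subst hvp
        simp
      · have h3 := hG.1.pos_dist_of_ne hvp
        rcases (by omega : G.dist v p = 1 ∨ G.dist v p = 2) with h | h <;> simp [h, hvp]
    rw [Finset.sum_congr rfl hpt, Finset.sum_add_distrib, Finset.sum_add_distrib,
      Finset.sum_ite_eq, if_pos hvF, ← Finset.sum_filter, Finset.sum_const, Finset.sum_const,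
      hc₁, ← hm]
    simp only [nsmul_eq_mul]
    ring
  have hsum₂ : ∑ p ∈ F₂, q ^ G.dist v p =
      cNum G 3 * q ^ 3 + cNum G 2 * (q - q ^ 3) + t * (q ^ 2 - q ^ 3) := by
    have hpt : ∀ p ∈ F₂, q ^ G.dist v p = q ^ 3 + ((if G.dist v p = 1 then q - q ^ 3 else 0) +
        if G.dist v p = 2 then q ^ 2 - q ^ 3 else 0) := by
      intro p hp
      simp only [hF₂, Finset.mem_filter, SimpleGraph.mem_neighborFinset] at hp
      have h1 := hG.1.dist_triangle (u := v) (v := z) (w := p)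
      have h2 := SimpleGraph.dist_eq_one_iff_adj.2 hp.1
      have h3 := hG.1.dist_triangle (u := p) (v := v) (w := u)
      have h4 := SimpleGraph.dist_comm (G := G) (u := p) (v := v)
      rcases (by omega : G.dist v p = 1 ∨ G.dist v p = 2 ∨ G.dist v p = 3) with h | h | h <;>
        simp [h]
    rw [Finset.sum_congr rfl hpt, Finset.sum_add_distrib, Finset.sum_add_distrib,
      ← Finset.sum_filter, ← Finset.sum_filter, Finset.sum_const, Finset.sum_const,
      Finset.sum_const, hc₂, hclose, ← ht]
    simp only [nsmul_eq_mul]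
    ring
  have hcn2 := hcl.2.1 2 (by omega) (by omega)
  have hcn3 := hcl.2.1 3 (by omega) hD
  simp only [bracket, Finset.sum_range_succ, Finset.sum_range_zero] at hcn2 hcn3
  rw [hsum₁, hsum₂, hcn2, hcn3] at hbal
  -- After inserting `c_2` and `c_3` all terms without `m` or `t` cancel, including those in `α`.
  have hfac : (b - 1) * (b ^ 2 + b + 1) * (m * b - t) = 0 := by
    rw [← sub_eq_zero] at hbal
    rw [← mul_zero (b ^ 4), ← hbal, hq]
    field_simp
    ring
  have hmt : (m : ℝ) * b - t = 0 := by
    rcases mul_eq_zero.1 hfac with h | h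
    · rcases mul_eq_zero.1 h with h | h
      · linarith
      · nlinarith
    · exact h
  have hm' : (1 : ℝ) ≤ m := by exact_mod_cast hm1
  have ht' : (0 : ℝ) ≤ t := Nat.cast_nonneg t
  nlinarith

theorem IsDistanceRegular.not_isKite_two (hG : IsDistanceRegular G) {k : ℕ}
    (hk : G.IsRegularOfDegree k) {b α β : ℝ}
    (hcl : HasClassicalParameters G G.diam b α β) (hneg : b < -1) (hD : 3 ≤ G.diam)
    (u v w z : V) : ¬ IsKite G 2 u v w z := by
  rintro ⟨huv, huw, hvw, huz, hvz, hwz⟩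
  obtain ⟨y, hy, hyu⟩ := hG.exists_farther_neighbor (x := z) (z := u)
    (by rw [SimpleGraph.dist_comm]; omega)
  rw [SimpleGraph.dist_comm (u := z), huz, SimpleGraph.dist_comm] at hyu
  have hzy := SimpleGraph.dist_eq_one_iff_adj.2 hy
  have hdist : ∀ p, G.Adj u p → G.dist p z = 1 → G.dist p y = 2 := by
    intro p hp hpz
    have h1 := hG.1.dist_triangle (u := p) (v := z) (w := y)
    have h2 := hG.1.dist_triangle (u := u) (v := p) (w := y)
    have h3 := SimpleGraph.dist_eq_one_iff_adj.2 hp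
    omega
  exact hG.not_isKite_three hk hcl hneg u v w y
    ⟨huv, huw, hvw, hyu, hdist v huv hvz, hdist w huw hwz⟩

end Kites

/-! ### Graphs with transitive adjacency -/

section Cliques

variable {W : Type*} [Fintype W] [DecidableEq W] {H : SimpleGraph W} [DecidableRel H.Adj]

theorem exists_isDisjointUnionOfCliques
    (htrans : ∀ y z w, H.Adj y z → H.Adj z w → y ≠ w → H.Adj y w) {a : ℕ}
    (hreg : H.IsRegularOfDegree a) :
    ∃ m, m * (a + 1) = Fintype.card W ∧ IsDisjointUnionOfCliques H m (a + 1) := by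
  let s : Setoid W :=
    { r := fun y z => y = z ∨ H.Adj y z
      iseqv :=
        { refl := fun _ => Or.inl rfl
          symm := fun h => h.imp Eq.symm fun h => h.symm
          trans := by
            rintro y z w (rfl | h1) (rfl | h2)
            · exact Or.inl rfl
            · exact Or.inr h2
            · exact Or.inr h1
            · by_cases h : y = w
              · exact Or.inl h
              · exact Or.inr (htrans y z w h1 h2 h) } }
  have : DecidableRel s := fun y z => inferInstanceAs (Decidable (y = z ∨ H.Adj y z))
  have hmem : ∀ y z, z ∈ (Finpartition.ofSetoid s).part y ↔ y = z ∨ H.Adj y z :=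
    fun y z => Finpartition.mem_part_ofSetoid_iff_rel
  have hcard : ∀ C ∈ (Finpartition.ofSetoid s).parts, C.card = a + 1 := by
    intro C hC
    obtain ⟨y, hy⟩ := (Finpartition.ofSetoid s).nonempty_of_mem_parts hC
    rw [← (Finpartition.ofSetoid s).part_eq_of_mem hC hy]
    have : (Finpartition.ofSetoid s).part y = insert y (H.neighborFinset y) := by
      ext z
      rw [hmem, Finset.mem_insert, SimpleGraph.mem_neighborFinset, eq_comm]
    rw [this, Finset.card_insert_of_notMem (by simp), SimpleGraph.card_neighborFinset_eq_degree,
      hreg.degree_eq]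
  refine ⟨(Finpartition.ofSetoid s).parts.card, ?_, Finpartition.ofSetoid s, rfl, hcard, ?_⟩
  · rw [← Finset.card_univ, ← (Finpartition.ofSetoid s).sum_card_parts,
      Finset.sum_congr rfl hcard, Finset.sum_const, smul_eq_mul]
  · intro y z
    constructor
    · intro h
      refine ⟨h.ne, (Finpartition.ofSetoid s).part y,
        (Finpartition.ofSetoid s).part_mem.2 (Finset.mem_univ y), ?_, ?_⟩
      · exact (hmem y y).2 (Or.inl rfl)
      · exact (hmem y z).2 (Or.inr h)
    · rintro ⟨hne, C, hC, hy, hz⟩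
      rw [← (Finpartition.ofSetoid s).part_eq_of_mem hC hy, hmem] at hz
      exact hz.resolve_left hne

theorem adjMatrix_add_one_sq (htrans : ∀ y z w, H.Adj y z → H.Adj z w → y ≠ w → H.Adj y w)
    {a : ℕ} (hreg : H.IsRegularOfDegree a) :
    (H.adjMatrix ℂ + 1) * (H.adjMatrix ℂ + 1) = ((a : ℂ) + 1) • (H.adjMatrix ℂ + 1) := by
  -- Adjacent vertices have `a - 1` common neighbours, and distinct nonadjacent ones have none.
  have hmul : H.adjMatrix ℂ * H.adjMatrix ℂ =
      (a : ℂ) • (1 : Matrix W W ℂ) + ((a : ℂ) - 1) • H.adjMatrix ℂ := by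
    ext y z
    rw [SimpleGraph.adjMatrix_mul_apply]
    simp only [SimpleGraph.adjMatrix_apply, Matrix.add_apply, Matrix.smul_apply, smul_eq_mul]
    rw [Finset.sum_boole]
    by_cases hyz : y = z
    · subst hyz
      rw [Finset.filter_true_of_mem fun w hw => ((H.mem_neighborFinset y w).1 hw).symm,
        SimpleGraph.card_neighborFinset_eq_degree, hreg.degree_eq]
      simp
    · rw [Matrix.one_apply_ne hyz]
      by_cases h : H.Adj y z
      · have : (H.neighborFinset y).filter (fun w => H.Adj w z) =
            (H.neighborFinset y).erase z := by
          ext w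
          simp only [Finset.mem_filter, Finset.mem_erase, SimpleGraph.mem_neighborFinset]
          exact ⟨fun h' => ⟨h'.2.ne, h'.1⟩, fun h' => ⟨h'.2, htrans w y z h'.2.symm h h'.1⟩⟩
        have hz : z ∈ H.neighborFinset y := by simpa using h
        have hc := Finset.card_erase_add_one hz
        rw [SimpleGraph.card_neighborFinset_eq_degree, hreg.degree_eq] at hc
        rw [this, if_pos h]
        have hc' : (((H.neighborFinset y).erase z).card : ℂ) + 1 = a := by exact_mod_cast hc
        linear_combination hc'
      · rw [Finset.filter_false_of_mem, if_neg h]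
        · simp
        · intro w hw hwz
          exact h (htrans y w z ((H.mem_neighborFinset y w).1 hw) hwz hyz)
  rw [mul_add, add_mul, hmul, mul_one, one_mul, smul_add, sub_smul, add_smul, add_smul, one_smul,
    one_smul]
  abel

end Cliques

/-! ### Eigenspaces from a quadratic equation -/

section Spectrum

variable {M : Type*} [AddCommGroup M] [Module ℂ M] {f : Module.End ℂ M}
  {a : ℂ}

theorem isProj_eigenspace (ha : a + 1 ≠ 0) (hf : (f + 1) * (f + 1) = (a + 1) • (f + 1)) :
    LinearMap.IsProj (f.eigenspace a) ((a + 1)⁻¹ • (f + 1)) := by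
  have hf' : ∀ v, f (f v) + f v + (f v + v) = (a + 1) • (f v + v) := fun v => by
    simpa using LinearMap.congr_fun hf v
  constructor
  · intro v
    rw [Module.End.mem_eigenspace_iff]
    have : f (f v + v) = a • (f v + v) := by
      rw [map_add, eq_sub_of_add_eq (hf' v), add_smul, one_smul, add_sub_cancel_right]
    simp only [LinearMap.smul_apply, LinearMap.add_apply, Module.End.one_apply, map_smul, this]
    rw [smul_comm]
  · intro v hv
    rw [Module.End.mem_eigenspace_iff] at hv
    simp only [LinearMap.smul_apply, LinearMap.add_apply, Module.End.one_apply, hv]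
    nth_rewrite 2 [← one_smul ℂ v]
    rw [← add_smul, smul_smul, inv_mul_cancel₀ ha, one_smul]

theorem isProj_eigenspace_neg_one (ha : a + 1 ≠ 0)
    (hf : (f + 1) * (f + 1) = (a + 1) • (f + 1)) :
    LinearMap.IsProj (f.eigenspace (-1)) (1 - (a + 1)⁻¹ • (f + 1)) := by
  have hf' : ∀ v, f (f v) + f v + (f v + v) = (a + 1) • (f v + v) := fun v => by
    simpa using LinearMap.congr_fun hf v
  constructor
  · intro v
    rw [Module.End.mem_eigenspace_iff, ← sub_eq_zero]
    simp only [LinearMap.sub_apply, LinearMap.smul_apply, LinearMap.add_apply,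
      Module.End.one_apply, map_sub, map_smul, map_add]
    have h : (a + 1)⁻¹ • (f (f v) + f v + (f v + v)) = f v + v := by
      rw [hf', smul_smul, inv_mul_cancel₀ ha, one_smul]
    rw [smul_add] at h
    rw [neg_smul, one_smul]
    have h2 : f v - (a + 1)⁻¹ • (f (f v) + f v) - -(v - (a + 1)⁻¹ • (f v + v)) =
        f v + v - ((a + 1)⁻¹ • (f (f v) + f v) + (a + 1)⁻¹ • (f v + v)) := by abel
    rw [h2, h, sub_self]
  · intro v hv
    rw [Module.End.mem_eigenspace_iff] at hv
    simp [hv]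

theorem eq_or_eq_neg_one_of_hasEigenvalue (hf : (f + 1) * (f + 1) = (a + 1) • (f + 1)) {θ : ℂ}
    (hθ : f.HasEigenvalue θ) : θ = a ∨ θ = -1 := by
  obtain ⟨v, hv⟩ := hθ.exists_hasEigenvector
  have hv' := hv.apply_eq_smul
  have h : ((θ + 1) * (θ - a)) • v = 0 := by
    have := LinearMap.congr_fun hf v
    simp only [Module.End.mul_apply, LinearMap.add_apply, Module.End.one_apply, hv', map_add,
      map_smul, LinearMap.smul_apply] at this
    rw [← sub_eq_zero] at this
    rw [← this]
    module
  rcases mul_eq_zero.1 ((smul_eq_zero.1 h).resolve_right hv.2) with h | h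
  · exact Or.inr (eq_neg_of_add_eq_zero_left h)
  · exact Or.inl (sub_eq_zero.1 h)

variable [FiniteDimensional ℂ M]

/-- The dimension of the range of a projection is its trace, and `f` itself contributes nothing. -/
theorem finrank_eigenspace (ha : a + 1 ≠ 0) (hf : (f + 1) * (f + 1) = (a + 1) • (f + 1))
    (htr : LinearMap.trace ℂ M f = 0) :
    (Module.finrank ℂ (f.eigenspace a) : ℂ) = Module.finrank ℂ M / (a + 1) := by
  rw [← (isProj_eigenspace ha hf).trace, map_smul, map_add, htr, LinearMap.trace_one, zero_add,
    smul_eq_mul, div_eq_inv_mul]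

theorem finrank_eigenspace_neg_one (ha : a + 1 ≠ 0)
    (hf : (f + 1) * (f + 1) = (a + 1) • (f + 1)) (htr : LinearMap.trace ℂ M f = 0) :
    (Module.finrank ℂ (f.eigenspace (-1)) : ℂ) = Module.finrank ℂ M * a / (a + 1) := by
  rw [← (isProj_eigenspace_neg_one ha hf).trace, map_sub, map_smul, map_add, htr,
    LinearMap.trace_one, zero_add, smul_eq_mul]
  field_simp
  ring

end Spectrum

end DistReg

theorem corollary4p5 {V : Type*} [Fintype V] [DecidableEq V] (G : SimpleGraph V)
    [DecidableRel G.Adj] (D : ℕ) (b α β : ℝ) (k : ℕ)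
    (hG : DistReg.IsDistanceRegular G)
    (hcl : DistReg.HasClassicalParameters G D b α β) (hD : 3 ≤ D)
    (hk : G.IsRegularOfDegree k) (ha : DistReg.aNum G 1 ≠ 0)
    (hneg : b < -1) (hnear : ¬ DistReg.IsNearPolygon G) (x : V) :
    (∃ m : ℕ, (m : ℚ) = (k : ℚ) / ((DistReg.aNum G 1 : ℚ) + 1) ∧
      DistReg.IsDisjointUnionOfCliques (DistReg.localGraph G x) m (DistReg.aNum G 1 + 1)) ∧
    (∀ θ : ℂ, (DistReg.localAdj G x).HasEigenvalue θ ↔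
      θ = (DistReg.aNum G 1 : ℂ) ∨ θ = -1) ∧
    (Module.finrank ℂ ((DistReg.localAdj G x).eigenspace (DistReg.aNum G 1 : ℂ)) : ℚ) =
      (k : ℚ) / ((DistReg.aNum G 1 : ℚ) + 1) ∧
    (Module.finrank ℂ ((DistReg.localAdj G x).eigenspace (-1)) : ℚ) =
      (k : ℚ) * (DistReg.aNum G 1 : ℚ) / ((DistReg.aNum G 1 : ℚ) + 1) := by
  obtain rfl : G.diam = D := hcl.1
  set a := DistReg.aNum G 1
  have htrans : ∀ y z w, (DistReg.localGraph G x).Adj y z → (DistReg.localGraph G x).Adj z w →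
      y ≠ w → (DistReg.localGraph G x).Adj y w := by
    rintro ⟨y, hy⟩ ⟨z, hz⟩ ⟨w, hw⟩ hyz hzw hne
    simp only [SimpleGraph.comap_adj, Function.Embedding.subtype_apply, ne_eq,
      Subtype.mk.injEq] at *
    by_contra hyw
    have h1 := hG.1.one_lt_dist_of_ne_of_not_adj hne hyw
    have h2 := hG.1.dist_triangle (u := y) (v := x) (w := w)
    have h3 := SimpleGraph.dist_eq_one_iff_adj.2 hy.symm
    have h4 := SimpleGraph.dist_eq_one_iff_adj.2 hw
    -- Nonadjacent `y` and `w` with common neighbours `x` and `z` form a kite of length 2, as `x`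
    -- and `z` are adjacent.
    exact hG.not_isKite_two hk hcl hneg hD y x z w ⟨hy.symm, hyz, hz, by omega, h4,
      SimpleGraph.dist_eq_one_iff_adj.2 hzw⟩
  have hreg : (DistReg.localGraph G x).IsRegularOfDegree a := by
    intro y
    rw [show a = _ from (hG.card_common_neighbor (by omega) y.2).symm, ← SimpleGraph.card_neighborFinset_eq_degree,
      ← Finset.card_map (Function.Embedding.subtype _)]
    congr 1
    ext w
    simp
    tauto
  have hcardW : Fintype.card (G.neighborSet x) = k := by
    rw [SimpleGraph.card_neighborSet_eq_degree, hk.degree_eq]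
  have ha1 : (a : ℂ) + 1 ≠ 0 := by exact_mod_cast Nat.succ_ne_zero a
  have hf : (DistReg.localAdj G x + 1) * (DistReg.localAdj G x + 1) =
      ((a : ℂ) + 1) • (DistReg.localAdj G x + 1) := by
    have h := congrArg Matrix.toLinAlgEquiv' (DistReg.adjMatrix_add_one_sq htrans hreg)
    simp only [map_mul, map_add, map_one, map_smul] at h
    exact h
  have htr : LinearMap.trace ℂ _ (DistReg.localAdj G x) = 0 := by
    rw [DistReg.localAdj, Matrix.trace_toLin'_eq, SimpleGraph.trace_adjMatrix]
  have hfr : Module.finrank ℂ (G.neighborSet x → ℂ) = k := by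
    rw [Module.finrank_fintype_fun_eq_card, hcardW]
  have hk0 : k ≠ 0 := by
    rintro rfl
    have := hG.exists_farther_neighbor (x := x) (z := x) (by simp; omega)
    obtain ⟨w, hw, -⟩ := this
    have h := hk.degree_eq x
    rw [SimpleGraph.degree_eq_zero] at h
    exact h w hw
  have hd1 := DistReg.finrank_eigenspace ha1 hf htr
  have hd2 := DistReg.finrank_eigenspace_neg_one ha1 hf htr
  rw [hfr] at hd1 hd2
  refine ⟨?_, fun θ => ⟨DistReg.eq_or_eq_neg_one_of_hasEigenvalue hf, ?_⟩, ?_, ?_⟩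
  · obtain ⟨m, hm, hm'⟩ := DistReg.exists_isDisjointUnionOfCliques htrans hreg
    refine ⟨m, ?_, hm'⟩
    rw [eq_div_iff (by positivity), ← hcardW, ← hm]
    push_cast
    rfl
  · rintro (rfl | rfl) hbot
    · change (DistReg.localAdj G x).eigenspace _ = ⊥ at hbot
      rw [hbot, finrank_bot, Nat.cast_zero, eq_comm, div_eq_zero_iff] at hd1
      simp [hk0, ha1] at hd1
    · change (DistReg.localAdj G x).eigenspace _ = ⊥ at hbot
      rw [hbot, finrank_bot, Nat.cast_zero, eq_comm, div_eq_zero_iff] at hd2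
      simp [hk0, ha1, a, ha] at hd2
  · apply Rat.cast_injective (α := ℂ)
    push_cast
    exact hd1
  · apply Rat.cast_injective (α := ℂ)
    push_cast
    exact hd2
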